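/- Let $q$ be a prime power, let $k$ and $n$ be positive integers with $n \ge \binom{k+1}{2}$, and let $\mathcal{G}_q(n,k)$ be the set of all $k$-dimensional $\mathbb{F}_q$-subspaces of $\mathbb{F}_{q^n}$. A subspace $V \in \mathcal{G}_q(n,k)$ is called a Sidon space if for all nonzero $a,b,c,d \in V$ with $ab = cd$ one has $\{a\mathbb{F}_q, b\mathbb{F}_q\} = \{c\mathbb{F}_q, d\mathbb{F}_q\}$, where $a\mathbb{F}_q = \{\lambda a : \lambda \in \mathbb{F}_q\}$. It is called a max-span Sidon space if it is a Sidon space and, in addition, $\dim_{\mathbb{F}_q} V^2 = \binom{k+1}{2}$, where $V^2$ is the $\mathbb{F}_q$-linear span of $\{uv : u,v \in V\}$. Then all but a fraction of less than $$\frac{1}{q-1}\cdot q^{k(k+1)/2-n}$$ of the spaces in $\mathcal{G}_q(n,k)$ are max-span Sidon spaces; that is, $$\frac{\left|\{V \in \mathcal{G}_q(n,k) : V \text{ is not a max-span Sidon space}\}\right|}{|\mathcal{G}_q(n,k)|} < \frac{1}{q-1}\cdot q^{k(k+1)/2-n}.$$ -/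

import Mathlib

/-- The set of all `k`-dimensional `F`-subspaces of `L`. -/
def grassmannian (F L : Type*) [Field F] [Field L] [Algebra F L] (k : ℕ) :
    Set (Submodule F L) :=
  {V | Module.finrank F V = k}

/-- `V` is a Sidon space if for all nonzero `a, b, c, d ∈ V` with `a * b = c * d` one has
`{aF, bF} = {cF, dF}`, where `aF = {t • a | t ∈ F}` is the `F`-line through `a`. -/
def IsSidonSpace {F L : Type*} [Field F] [Field L] [Algebra F L] (V : Submodule F L) : Prop :=
  ∀ a ∈ V, ∀ b ∈ V, ∀ c ∈ V, ∀ d ∈ V, a ≠ 0 → b ≠ 0 → c ≠ 0 → d ≠ 0 → a * b = c * d →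
    ({Submodule.span F {a}, Submodule.span F {b}} : Set (Submodule F L)) =
      {Submodule.span F {c}, Submodule.span F {d}}

/-- The square of `V`: the `F`-span of all products `u * v` with `u, v ∈ V`. -/
def squareSpan {F L : Type*} [Field F] [Field L] [Algebra F L] (V : Submodule F L) :
    Submodule F L :=
  Submodule.span F {x | ∃ u ∈ V, ∃ v ∈ V, x = u * v}

/-- `V` is a max-span Sidon space if it is a Sidon space and the dimension of its square is
`(k + 1).choose 2`, where `k` is the dimension of `V`. -/
def IsMaxSpanSidonSpace {F L : Type*} [Field F] [Field L] [Algebra F L]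
    (V : Submodule F L) : Prop :=
  IsSidonSpace V ∧
    Module.finrank F (squareSpan V) = (Module.finrank F V + 1).choose 2

/-!
Let `V` have the basis `v`, a tuple of `k` elements of `L`. A linear relation between the products
`vᵢ vⱼ` is a quadratic form `Q` over `F` in `k` variables with `Q(v) = 0`. If there is no such
`Q ≠ 0`, then `dim V² = (k + 1).choose 2`, and `V` is a Sidon space because products of two linear
forms factor uniquely (`isMaxSpanSidonSpace_span`). As all subspaces of dimension `k` have equally
many bases, it suffices to bound the sum over all `Q ≠ 0` of the number `N(Q)` of linearly
independent tuples annihilated by `Q`; a bad tuple is counted at least `|F| - 1` times in this sum.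

To bound `N(Q)`, move an independent tuple `w` along the line `w + t e`, with `t` in `L` and a
direction `e` over `F`. All but at most `|F| ^ (k - 1)` points of this line are independent
(`card_dependent_le`). If `Q` has a zero `e` over `F` outside its radical, then `Q` is linear and
nonconstant on all these lines, so with `T` the number of independent tuples
`N(Q) (|L| - |F| ^ (k - 1)) ≤ T`. For arbitrary `Q ≠ 0` the same holds with `2 T` on the right.
Finally `N(Q) = 0` if `Q ≠ 0` is a product of linear forms over `F`.

The factor two matters only for forms which are anisotropic modulo their radical and are not
products. By the Chevalley–Warning theorem these have rank two, so they are homogenized irreducible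
quadratic polynomials in one variable. There are at most as many of those as there are split ones
with distinct roots (`card_rootlessQuadratics_le`), and the latter give forms with `N(Q) = 0` which
have a zero outside the radical (`exists_injOn_anisotropic`). So on average the factor is at most
one. The squares of linear forms, which have `N(Q) = 0` too, make up for the difference between
`|L| - |F| ^ (k - 1)` and `|L|`; this gives the strict inequality.
-/

open Finset

/-! ### Quadratic and linear forms evaluated in extension algebras -/

section QuadraticForms

variable {F A B ι : Type*} [Field F] [CommRing A] [Algebra F A] [CommRing B] [Algebra F B]
  [Fintype ι]

/-- The value at `v` of the homogeneous quadratic polynomial over `F` whose coefficient at the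
monomial `xᵢ xⱼ` is `c s(i, j)`. The point `v` may have coordinates in any commutative
`F`-algebra. -/
def quadEval [DecidableEq ι] (c : Sym2 ι → F) (v : ι → A) : A := ∑ z, c z • (z.map v).mul

/-- The polar form `Q(v + w) - Q(v) - Q(w)` of the quadratic polynomial `Q` with
coefficients `c`. -/
def quadPolar [DecidableEq ι] (c : Sym2 ι → F) (v w : ι → A) : A :=
  ∑ z, c z • Sym2.lift ⟨fun i j => v i * w j + v j * w i, fun _ _ => add_comm _ _⟩ z

/-- The value at `v` of the linear form over `F` with coefficients `a`. -/
def linEval (a : ι → F) (v : ι → A) : A := ∑ i, a i • v i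

/-- The coefficients of the product of the linear forms with coefficients `a` and `b`. -/
def prodForm [DecidableEq ι] (a b : ι → F) : Sym2 ι → F :=
  ∑ i, ∑ j, Pi.single s(i, j) (a i * b j)

section LinEval

lemma linEval_add (a : ι → F) (v w : ι → A) : linEval a (v + w) = linEval a v + linEval a w := by
  simp [linEval, sum_add_distrib]

lemma linEval_sub (a : ι → F) (v w : ι → A) :
    linEval a (v - w) = linEval a v - linEval a w := by
  rw [eq_sub_iff_add_eq, ← linEval_add, sub_add_cancel]

lemma linEval_smul (a : ι → F) (t : A) (v : ι → A) : linEval a (t • v) = t * linEval a v := by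
  simp [linEval, mul_sum]

lemma linEval_add_left (a b : ι → F) (v : ι → A) :
    linEval (a + b) v = linEval a v + linEval b v := by
  simp [linEval, add_smul, sum_add_distrib]

lemma linEval_smul_left (r : F) (a : ι → F) (v : ι → A) :
    linEval (r • a) v = r • linEval a v := by
  simp [linEval, mul_smul, smul_sum]

lemma linEval_single [DecidableEq ι] (a : ι → F) (i : ι) :
    linEval a (Pi.single i (1 : A)) = algebraMap F A (a i) := by
  simp [linEval, Pi.single_apply, Algebra.algebraMap_eq_smul_one]

lemma linEval_ne_zero {a : ι → F} (ha : a ≠ 0) {v : ι → A} (hv : LinearIndependent F v) :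
    linEval a v ≠ 0 := fun h =>
  ha (funext fun i => Fintype.linearIndependent_iff.mp hv a h i)

end LinEval

variable [DecidableEq ι]

lemma quadEval_add_vec (c : Sym2 ι → F) (v w : ι → A) :
    quadEval c (v + w) = quadEval c v + quadEval c w + quadPolar c v w := by
  simp only [quadEval, quadPolar, ← sum_add_distrib, ← smul_add]
  refine sum_congr rfl fun z _ => ?_
  induction z with | _ i j => ?_
  congr 1
  simp only [Sym2.map_mk, Sym2.mul_mk, Sym2.lift_mk, Pi.add_apply]
  ring

lemma quadEval_smul_vec (c : Sym2 ι → F) (t : A) (v : ι → A) :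
    quadEval c (t • v) = t ^ 2 * quadEval c v := by
  simp only [quadEval, mul_sum]
  refine sum_congr rfl fun z _ => ?_
  induction z with | _ i j => ?_
  rw [mul_smul_comm]
  congr 1
  simp only [Sym2.map_mk, Sym2.mul_mk, Pi.smul_apply, smul_eq_mul]
  ring

lemma quadPolar_comm (c : Sym2 ι → F) (v w : ι → A) : quadPolar c v w = quadPolar c w v := by
  refine sum_congr rfl fun z _ => ?_
  induction z with | _ i j => ?_
  congr 1
  simp only [Sym2.lift_mk]
  ring

lemma quadPolar_add_right (c : Sym2 ι → F) (u v w : ι → A) :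
    quadPolar c u (v + w) = quadPolar c u v + quadPolar c u w := by
  simp only [quadPolar, ← sum_add_distrib, ← smul_add]
  refine sum_congr rfl fun z _ => ?_
  induction z with | _ i j => ?_
  congr 1
  simp only [Sym2.lift_mk, Pi.add_apply]
  ring

lemma quadPolar_smul_right (c : Sym2 ι → F) (t : A) (v w : ι → A) :
    quadPolar c v (t • w) = t * quadPolar c v w := by
  simp only [quadPolar, mul_sum]
  refine sum_congr rfl fun z _ => ?_
  induction z with | _ i j => ?_
  rw [mul_smul_comm]
  congr 1
  simp only [Sym2.lift_mk, Pi.smul_apply, smul_eq_mul]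
  ring

lemma quadPolar_add_left (c : Sym2 ι → F) (u v w : ι → A) :
    quadPolar c (u + v) w = quadPolar c u w + quadPolar c v w := by
  rw [quadPolar_comm, quadPolar_add_right, quadPolar_comm c w u, quadPolar_comm c w v]

lemma quadPolar_smul_left (c : Sym2 ι → F) (t : A) (v w : ι → A) :
    quadPolar c (t • v) w = t * quadPolar c v w := by
  rw [quadPolar_comm, quadPolar_smul_right, quadPolar_comm]

lemma quadEval_map (f : A →ₐ[F] B) (c : Sym2 ι → F) (v : ι → A) :
    quadEval c (fun i => f (v i)) = f (quadEval c v) := by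
  simp only [quadEval, map_sum, map_smul]
  refine sum_congr rfl fun z _ => ?_
  induction z with | _ i j => ?_
  simp

lemma quadPolar_map (f : A →ₐ[F] B) (c : Sym2 ι → F) (v w : ι → A) :
    quadPolar c (fun i => f (v i)) (fun i => f (w i)) = f (quadPolar c v w) := by
  simp only [quadPolar, map_sum, map_smul]
  refine sum_congr rfl fun z _ => ?_
  induction z with | _ i j => ?_
  simp

lemma quadEval_add (c d : Sym2 ι → F) (v : ι → A) :
    quadEval (c + d) v = quadEval c v + quadEval d v := by
  simp [quadEval, add_smul, sum_add_distrib]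

lemma quadEval_smul (r : F) (c : Sym2 ι → F) (v : ι → A) :
    quadEval (r • c) v = r • quadEval c v := by
  simp [quadEval, mul_smul, smul_sum]

lemma quadEval_zero (v : ι → A) : quadEval (0 : Sym2 ι → F) v = 0 := by
  simp [quadEval]

lemma quadEval_zero_vec (c : Sym2 ι → F) : quadEval c (0 : ι → A) = 0 := by
  simpa using quadEval_smul_vec c (0 : A) (0 : ι → A)

lemma quadEval_sum {κ : Type*} (s : Finset κ) (c : κ → Sym2 ι → F) (v : ι → A) :
    quadEval (∑ k ∈ s, c k) v = ∑ k ∈ s, quadEval (c k) v := by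
  simp only [quadEval, Finset.sum_apply, sum_smul]
  exact sum_comm

lemma quadEval_single (i j : ι) (r : F) (v : ι → A) :
    quadEval (Pi.single s(i, j) r) v = r • (v i * v j) := by
  rw [quadEval, sum_eq_single s(i, j)]
  · simp
  · intro z _ hz
    simp [hz]
  · simp

lemma quadEval_prodForm (a b : ι → F) (v : ι → A) :
    quadEval (prodForm a b) v = linEval a v * linEval b v := by
  simp only [prodForm, quadEval_sum, quadEval_single, linEval, sum_mul_sum, smul_mul_smul_comm]

/-- A quadratic polynomial vanishing at all points with coordinates in `F` is zero. This holds even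
for `F` with two elements, as homogeneous forms of degree two distinguish `x²` from `x`. -/
lemma eq_zero_of_quadEval_eq_zero {c : Sym2 ι → F} (h : ∀ x : ι → F, quadEval c x = 0) :
    c = 0 := by
  have key : ∀ x y : ι → F, quadPolar c x y = 0 := fun x y => by
    have := quadEval_add_vec c x y
    simpa [h] using this.symm
  funext z
  induction z with | _ i j => ?_
  by_cases hij : i = j
  · subst hij
    have := h (Pi.single i 1)
    rw [quadEval, sum_eq_single s(i, i)] at this
    · simpa using this
    · intro z _ hz
      induction z with | _ a b => ?_
      have : ¬ (a = i ∧ b = i) := fun ⟨h1, h2⟩ => hz (by rw [h1, h2])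
      simp only [Sym2.map_mk, Sym2.mul_mk, Pi.single_apply, smul_eq_mul]
      grind
    · simp
  · have := key (Pi.single i 1) (Pi.single j 1)
    rw [quadPolar, sum_eq_single s(i, j)] at this
    · simpa [Pi.single_apply, hij] using this
    · intro z _ hz
      induction z with | _ a b => ?_
      have h1 : ¬ (a = i ∧ b = j) := fun ⟨h1, h2⟩ => hz (by rw [h1, h2])
      have h2 : ¬ (a = j ∧ b = i) := fun ⟨h1, h2⟩ => hz (by rw [h1, h2, Sym2.eq_swap])
      simp only [Sym2.lift_mk, Pi.single_apply, smul_eq_mul]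
      grind
    · simp

lemma quad_ext {c d : Sym2 ι → F} (h : ∀ x : ι → F, quadEval c x = quadEval d x) : c = d := by
  have : c + (-1 : F) • d = 0 := eq_zero_of_quadEval_eq_zero fun x => by
    rw [quadEval_add, quadEval_smul, h]; simp
  simpa [← sub_eq_add_neg, sub_eq_zero] using this

lemma quadEval_algebraMap (c : Sym2 ι → F) (x : ι → F) :
    quadEval c (algebraMap F A ∘ x) = algebraMap F A (quadEval c x) :=
  quadEval_map (Algebra.ofId F A) c x

lemma quadPolar_algebraMap (c : Sym2 ι → F) (x : ι → F) (v : ι → A) :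
    quadPolar c (algebraMap F A ∘ x) v
      = linEval (fun i => quadPolar c x (Pi.single i 1)) v := by
  have hv : v = ∑ i, v i • (Pi.single i (1 : A) : ι → A) := by
    funext j; simp [Finset.sum_apply, Pi.single_apply]
  have hs : ∀ (s : Finset ι) (f : ι → ι → A) (u : ι → A),
      quadPolar c u (∑ i ∈ s, f i) = ∑ i ∈ s, quadPolar c u (f i) := by
    intro s f u
    induction s using Finset.induction_on with
    | empty => simpa using quadPolar_smul_right c (0 : A) u 0
    | insert i s hi ih => rw [sum_insert hi, sum_insert hi, quadPolar_add_right, ih]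
  conv_lhs => rw [hv]
  rw [hs, linEval]
  refine sum_congr rfl fun i _ => ?_
  rw [quadPolar_smul_right]
  have h := quadPolar_map (Algebra.ofId F A) c x (Pi.single i 1)
  have h1 : (fun j => Algebra.ofId F A ((Pi.single i (1 : F) : ι → F) j)) =
      Pi.single i (1 : A) := by
    funext j
    simp only [Pi.single_apply]
    split_ifs <;> simp
  rw [h1] at h
  rw [Algebra.smul_def, mul_comm]
  congr 1

end QuadraticForms

/-! ### Counting zeros on rational lines -/

section Counting

variable {F L ι : Type*} [Field F] [Field L] [Algebra F L] [Fintype ι] [DecidableEq ι]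

open Classical in
lemma card_quadratic_roots_le_two {K : Type*} [Field K] [Fintype K] {a : K} (ha : a ≠ 0)
    (b c : K) : #{t : K | a * t ^ 2 + b * t + c = 0} ≤ 2 := by
  set p : Polynomial K := .C a * .X ^ 2 + .C b * .X + .C c with hp
  have hp2 : p.natDegree = 2 := Polynomial.natDegree_quadratic ha
  have hp0 : p ≠ 0 := fun h => by simp [h] at hp2
  calc #{t : K | a * t ^ 2 + b * t + c = 0} ≤ #p.roots.toFinset := by
        refine card_le_card fun t ht => ?_
        rw [Multiset.mem_toFinset, Polynomial.mem_roots hp0]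
        simpa [hp] using ht
    _ ≤ p.roots.card := Multiset.toFinset_card_le _
    _ ≤ 2 := hp2 ▸ p.card_roots'

lemma quadEval_line (c : Sym2 ι → F) (e : ι → F) (w : ι → L) (t : L) :
    quadEval c (w + t • (algebraMap F L ∘ e)) = algebraMap F L (quadEval c e) * t ^ 2
      + linEval (fun i => quadPolar c e (Pi.single i 1)) w * t + quadEval c w := by
  rw [quadEval_add_vec, quadEval_smul_vec, quadPolar_comm, quadPolar_smul_left,
    quadPolar_algebraMap, quadEval_algebraMap]
  ring

open Classical in
/-- The `F`-linearly independent tuples of elements of `L`. -/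
noncomputable def indepTuples (F L ι : Type*) [Field F] [Field L] [Algebra F L] [Fintype ι]
    [Fintype L] : Finset (ι → L) := {v | LinearIndependent F v}

open Classical in
/-- The `F`-linearly independent zeros in `L` of the quadratic polynomial with coefficients `c`. -/
noncomputable def indepZeros (L : Type*) [Field L] [Algebra F L] [Fintype L] (c : Sym2 ι → F) :
    Finset (ι → L) := {v | LinearIndependent F v ∧ quadEval c v = 0}

lemma indepZeros_prodForm [Fintype L] {a b : ι → F} (h : prodForm a b ≠ 0) :
    indepZeros L (prodForm a b) = ∅ := by
  classical
  refine filter_eq_empty_iff.mpr fun v _ hv => ?_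
  have ha : a ≠ 0 := by
    rintro rfl
    exact h (by simp [prodForm])
  have hb : b ≠ 0 := by
    rintro rfl
    exact h (by simp [prodForm])
  rw [quadEval_prodForm] at hv
  exact mul_ne_zero (linEval_ne_zero ha hv.1) (linEval_ne_zero hb hv.1) hv.2

variable [Fintype F] [Fintype L]

open Classical in
lemma card_eval_eq_one_le {e : ι → F} (he : e ≠ 0) :
    Fintype.card {g : ι → F // linEval g e = (1 : F)} ≤ Fintype.card F ^ (Fintype.card ι - 1) := by
  obtain ⟨i, hi⟩ := Function.ne_iff.mp he
  have hcard : Fintype.card ({j : ι // j ≠ i} → F) = Fintype.card F ^ (Fintype.card ι - 1) := by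
    simp
  rw [← hcard]
  refine Fintype.card_le_of_injective (fun g (j : {j // j ≠ i}) => g.1 j) ?_
  intro g h hgh
  have hne : ∀ j, j ≠ i → g.1 j = h.1 j := fun j hj => congrFun hgh ⟨j, hj⟩
  refine Subtype.ext (funext fun j => ?_)
  by_cases hj : j = i
  · subst hj
    have h1 := g.2.trans h.2.symm
    simp only [linEval] at h1
    rw [← add_sum_erase _ _ (mem_univ j), ← add_sum_erase (a := j) _ _ (mem_univ j)] at h1
    rw [sum_congr rfl fun l hl => by rw [hne l (ne_of_mem_erase hl)]] at h1
    exact mul_right_cancel₀ hi (add_right_cancel h1)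
  · exact hne j hj

open Classical in
/-- On the line through an independent tuple `v` in a direction `e` defined over `F`, at most
`|F| ^ (k - 1)` points are dependent: a relation `g` at `v + t e` can be scaled so that `g(e) = 1`,
and then it determines `t`. -/
lemma card_dependent_le {v : ι → L} (hv : LinearIndependent F v) {e : ι → F} (he : e ≠ 0) :
    #{t : L | ¬ LinearIndependent F (v + t • (algebraMap F L ∘ e))} ≤
      Fintype.card F ^ (Fintype.card ι - 1) := by
  refine le_trans ?_ (card_eval_eq_one_le he)
  rw [← Finset.card_univ]
  refine Finset.card_le_card_of_surjOn (fun g => - linEval g.1 v) ?_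
  intro t ht
  simp only [coe_filter, mem_univ, true_and, Set.mem_ofPred_eq] at ht
  rw [Fintype.linearIndependent_iff] at ht
  push Not at ht
  obtain ⟨g, hg, i, hi⟩ := ht
  have hg' : linEval g v + t * algebraMap F L (linEval g e) = 0 := by
    have : linEval g (v + t • (algebraMap F L ∘ e)) = 0 := hg
    rw [linEval_add, linEval_smul] at this
    rw [← this]
    simp [linEval, Algebra.smul_def]
  have hge : linEval g e ≠ 0 := by
    intro h0
    rw [h0, map_zero, mul_zero, add_zero] at hg'
    exact linEval_ne_zero (fun h => hi (by rw [h]; rfl)) hv hg'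
  refine ⟨⟨(linEval g e)⁻¹ • g, ?_⟩, by simp, ?_⟩
  · rw [linEval_smul_left, smul_eq_mul, inv_mul_cancel₀ hge]
  · have h2 : algebraMap F L (linEval g e) ≠ 0 := by simpa using hge
    change -linEval ((linEval g e)⁻¹ • g) v = t
    rw [linEval_smul_left, Algebra.smul_def, map_inv₀]
    field_simp
    linear_combination -hg'

open Classical in
/-- Translating the independent zeros along the direction `e` covers independent tuples at most
`d` times, if the polynomial has at most `d` zeros on each line in that direction. -/
lemma card_indepZeros_mul_le (c : Sym2 ι → F) {e : ι → F} (he : e ≠ 0) (d : ℕ)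
    (hd : ∀ w : ι → L, LinearIndependent F w →
      #{t : L | quadEval c (w + t • (algebraMap F L ∘ e)) = 0} ≤ d) :
    #(indepZeros L c) * (Fintype.card L - Fintype.card F ^ (Fintype.card ι - 1)) ≤
      d * #(indepTuples F L ι) := by
  set P : Finset (Σ _ : ι → L, L) := (indepZeros L c).sigma
    fun v => {t : L | LinearIndependent F (v + t • (algebraMap F L ∘ e))} with hP
  have h1 : #(indepZeros L c) * (Fintype.card L - Fintype.card F ^ (Fintype.card ι - 1)) ≤ #P := by
    rw [hP, card_sigma, ← smul_eq_mul]
    refine card_nsmul_le_sum _ _ _ fun v hv => ?_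
    have hv' : LinearIndependent F v := by
      simp only [indepZeros, mem_filter, mem_univ, true_and] at hv
      exact hv.1
    have := card_dependent_le hv' he
    have h3 := card_filter_add_card_filter_not (s := (univ : Finset L))
      (fun t => LinearIndependent F (v + t • (algebraMap F L ∘ e)))
    rw [Finset.card_univ] at h3
    omega
  refine h1.trans (card_le_mul_card_image_of_maps_to
    (f := fun p => p.1 + p.2 • (algebraMap F L ∘ e)) ?_ d ?_)
  · rintro ⟨v, t⟩ hp
    simp only [hP, mem_sigma, mem_filter, mem_univ, true_and] at hp
    simpa [indepTuples] using hp.2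
  · intro w hw
    refine le_trans ?_ (hd w (by simpa [indepTuples] using hw))
    refine card_le_card_of_injOn (fun p => - p.2) ?_ ?_
    · rintro ⟨v, t⟩ hp
      simp only [hP, indepZeros, coe_filter, mem_sigma, mem_filter, mem_univ, true_and,
        Set.mem_ofPred_eq] at hp ⊢
      rw [← hp.2]
      simpa using hp.1.1.2
    · rintro ⟨v, t⟩ hp ⟨v', t'⟩ hp' htt
      simp only [coe_filter, Set.mem_ofPred_eq, neg_inj] at hp hp' htt
      subst htt
      have := add_right_cancel (hp.2.trans hp'.2.symm)
      rw [this]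

lemma card_indepZeros_mul_le_two {c : Sym2 ι → F} (hc : c ≠ 0) :
    #(indepZeros L c) * (Fintype.card L - Fintype.card F ^ (Fintype.card ι - 1)) ≤
      2 * #(indepTuples F L ι) := by
  classical
  obtain ⟨e, he⟩ : ∃ e : ι → F, quadEval c e ≠ 0 := by
    by_contra! h
    exact hc (eq_zero_of_quadEval_eq_zero h)
  refine card_indepZeros_mul_le c (e := e) ?_ 2 fun w _ => ?_
  · rintro rfl
    exact he (quadEval_zero_vec c)
  · simp only [quadEval_line]
    exact card_quadratic_roots_le_two (by simpa using he) _ _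

/-- If the form has a zero over `F` outside its radical, then it is linear and nonconstant along
that direction, at every independent tuple. -/
lemma card_indepZeros_mul_le_one {c : Sym2 ι → F} {e x : ι → F} (he : quadEval c e = 0)
    (hx : quadPolar c e x ≠ 0) :
    #(indepZeros L c) * (Fintype.card L - Fintype.card F ^ (Fintype.card ι - 1)) ≤
      1 * #(indepTuples F L ι) := by
  classical
  refine card_indepZeros_mul_le c (e := e) ?_ 1 fun w hw => ?_
  · rintro rfl
    exact hx (by simpa using quadPolar_smul_left c (0 : F) 0 x)
  · have hm : (fun i => quadPolar c e (Pi.single i 1)) ≠ 0 := by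
      intro h0
      have h := quadPolar_algebraMap (A := F) c e x
      rw [h0] at h
      exact hx (h.trans (by simp [linEval]))
    have hw' := linEval_ne_zero hm hw
    simp only [quadEval_line, he, map_zero, zero_mul, zero_add]
    refine card_le_one.mpr fun s hs t ht => ?_
    simp only [mem_filter, mem_univ, true_and] at hs ht
    exact mul_left_cancel₀ hw' (by linear_combination hs - ht)

end Counting

/-! ### Monic quadratic polynomials over a finite field -/

section MonicQuadratics

variable (F : Type*) [Field F] [Fintype F]

open Classical in
/-- The pairs `(b, c)` for which `X² + bX + c` has no root. -/
noncomputable def rootlessQuadratics : Finset (F × F) := {p | ∀ t, t ^ 2 + p.1 * t + p.2 ≠ 0}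

open Classical in
/-- The pairs `(b, c)` for which `X² + bX + c` has two distinct roots. -/
noncomputable def splitQuadratics : Finset (F × F) :=
  {p | ∃ x y, x ≠ y ∧ p.1 = -(x + y) ∧ p.2 = x * y}

/-- The average number of roots of a monic quadratic polynomial over `F` is one, because `b` and a
root `t` determine `c`. Hence at least as many have two roots as have none. -/
lemma card_rootlessQuadratics_le : #(rootlessQuadratics F) ≤ #(splitQuadratics F) := by
  classical
  let r : F × F → ℕ := fun p => #{t : F | t ^ 2 + p.1 * t + p.2 = 0}
  have hr : ∑ p, r p = Fintype.card (F × F) := by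
    simp only [r]
    rw [← card_sigma (univ : Finset (F × F)) fun p => {t : F | t ^ 2 + p.1 * t + p.2 = 0},
      ← Finset.card_univ]
    refine card_bij' (fun p _ => (p.1.1, p.2)) (fun p _ => ⟨(p.1, -(p.2 ^ 2 + p.1 * p.2)), p.2⟩)
      ?_ ?_ ?_ ?_
    · simp
    · simp
    · rintro ⟨⟨b, c⟩, t⟩ h
      simp only [mem_sigma, mem_univ, mem_filter, true_and] at h
      have : -(t ^ 2 + b * t) = c := by linear_combination -h
      simp [this]
    · simp
  have key : ∀ p, r p + (if p ∈ rootlessQuadratics F then 1 else 0) ≤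
      1 + (if p ∈ splitQuadratics F then 1 else 0) := by
    rintro ⟨b, c⟩
    by_cases h0 : (b, c) ∈ rootlessQuadratics F
    · have : r (b, c) = 0 := by
        simp only [rootlessQuadratics, mem_filter, mem_univ, true_and] at h0
        simpa [r, filter_eq_empty_iff] using h0
      simp [this, h0]
    · by_cases h1 : (b, c) ∈ splitQuadratics F
      · have : r (b, c) ≤ 2 := by
          simpa [r] using card_quadratic_roots_le_two (one_ne_zero (α := F)) b c
        simpa [h0, h1] using this
      · simp only [h0, h1, if_false, add_zero]
        refine card_le_one.mpr fun x hx y hy => ?_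
        simp only [mem_filter, mem_univ, true_and] at hx hy
        by_contra hxy
        have hb : b = -(x + y) := mul_left_cancel₀ (sub_ne_zero.mpr hxy) (by
          linear_combination hx - hy)
        refine h1 ?_
        simp only [splitQuadratics, mem_filter, mem_univ, true_and]
        exact ⟨x, y, hxy, hb, by linear_combination hx - x * hb⟩
  have := sum_le_sum fun p (_ : p ∈ (univ : Finset (F × F))) => key p
  rw [sum_add_distrib, sum_add_distrib, hr] at this
  simpa using this

lemma exists_rootless_to_split : ∃ φ : F × F → F × F,
    (∀ p ∈ rootlessQuadratics F, φ p ∈ splitQuadratics F) ∧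
      Set.InjOn φ (rootlessQuadratics F) := by
  obtain ⟨f⟩ : Nonempty (rootlessQuadratics F ↪ splitQuadratics F) :=
    Function.Embedding.nonempty_of_card_le (by simpa using card_rootlessQuadratics_le F)
  classical
  refine ⟨fun p => if h : p ∈ rootlessQuadratics F then f ⟨p, h⟩ else p, ?_, ?_⟩
  · intro p hp
    simp [hp]
  · intro p hp p' hp' h
    rw [mem_coe] at hp hp'
    simp only [hp, hp', dif_pos] at h
    simpa using f.injective (Subtype.ext h)

end MonicQuadratics

/-! ### The radical of a quadratic form -/

section Radical

variable {F ι : Type*} [Field F] [Fintype ι] [DecidableEq ι]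

/-- The zeros over `F` of a quadratic form that are orthogonal to everything for its polar form. -/
def quadRadical (c : Sym2 ι → F) : Submodule F (ι → F) where
  carrier := {e | quadEval c e = 0 ∧ ∀ x, quadPolar c e x = 0}
  zero_mem' := ⟨quadEval_zero_vec c, fun x => by
    simpa using quadPolar_smul_left c (0 : F) (0 : ι → F) x⟩
  add_mem' := fun {a b} ha hb => ⟨by rw [quadEval_add_vec, ha.1, hb.1, ha.2]; simp, fun x => by
    rw [quadPolar_add_left, ha.2, hb.2, add_zero]⟩
  smul_mem' := fun t a ha => ⟨by rw [quadEval_smul_vec, ha.1, mul_zero], fun x => by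
    rw [quadPolar_smul_left, ha.2, mul_zero]⟩

lemma mem_quadRadical {c : Sym2 ι → F} {e : ι → F} :
    e ∈ quadRadical c ↔ quadEval c e = 0 ∧ ∀ x, quadPolar c e x = 0 := Iff.rfl

/-- A quadratic form is anisotropic modulo its radical if all its zeros over `F` lie in the
radical. -/
def IsAnisotropicModRadical (c : Sym2 ι → F) : Prop :=
  ∀ e : ι → F, quadEval c e = 0 → e ∈ quadRadical c

/-- A quadratic form is a product of two linear forms over `F`. -/
def IsLinearProduct (c : Sym2 ι → F) : Prop := ∃ a b, c = prodForm a b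

lemma quadEval_add_of_mem {c : Sym2 ι → F} {e : ι → F} (he : e ∈ quadRadical c) (x : ι → F) :
    quadEval c (x + e) = quadEval c x := by
  rw [quadEval_add_vec, quadPolar_comm, he.1, he.2, add_zero, add_zero]

/-- A quadratic form over a finite field has a nontrivial zero in the span of any three vectors,
by the Chevalley–Warning theorem. -/
lemma exists_isotropic_combination [Finite F] (c : Sym2 ι → F) (u : Fin 3 → ι → F) :
    ∃ x : Fin 3 → F, x ≠ 0 ∧ quadEval c (∑ i, x i • u i) = 0 := by
  classical
  have := Fintype.ofFinite F
  obtain ⟨p, hp⟩ := CharP.exists F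
  let P : MvPolynomial (Fin 3) F :=
    quadEval c fun j => ∑ i, MvPolynomial.C (u i j) * MvPolynomial.X i
  have hlin : ∀ j, (∑ i, MvPolynomial.C (u i j) * MvPolynomial.X i :
      MvPolynomial (Fin 3) F).totalDegree ≤ 1 := fun j => by
    refine MvPolynomial.totalDegree_finsetSum_le fun i _ => ?_
    refine (MvPolynomial.totalDegree_mul _ _).trans ?_
    simp
  have hdeg : P.totalDegree ≤ 2 := by
    refine MvPolynomial.totalDegree_finsetSum_le fun z _ => ?_
    refine (MvPolynomial.totalDegree_smul_le _ _).trans ?_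
    induction z with | _ i j => ?_
    simp only [Sym2.map_mk, Sym2.mul_mk]
    exact (MvPolynomial.totalDegree_mul _ _).trans (add_le_add (hlin i) (hlin j))
  have hev : ∀ x : Fin 3 → F, MvPolynomial.eval x P = quadEval c (∑ i, x i • u i) := fun x => by
    have := quadEval_map (MvPolynomial.aeval x) c
      fun j => ∑ i, MvPolynomial.C (u i j) * MvPolynomial.X i
    rw [← MvPolynomial.coe_aeval_eq_eval]
    refine this.symm.trans ?_
    congr 1
    funext j
    simp [Finset.sum_apply, mul_comm]
  have hdvd := char_dvd_card_solutions p (f := P) (by simpa using by omega)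
  have hp1 : p ≠ 1 := CharP.char_ne_one F p
  by_contra! h
  have : Fintype.card {x : Fin 3 → F // MvPolynomial.eval x P = 0} = 1 := by
    rw [Fintype.card_eq_one_iff]
    refine ⟨⟨0, by rw [hev]; simp [quadEval_zero_vec]⟩, fun y => Subtype.ext ?_⟩
    by_contra hy
    exact h y.1 hy (by rw [← hev, y.2])
  rw [this] at hdvd
  exact hp1 (Nat.dvd_one.mp hdvd)

lemma finrank_quotient_quadRadical_le_two [Finite F] {c : Sym2 ι → F}
    (hc : IsAnisotropicModRadical c) : Module.finrank F ((ι → F) ⧸ quadRadical c) ≤ 2 := by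
  by_contra! h
  obtain ⟨w, hw⟩ := exists_linearIndependent_of_le_finrank (n := 3) h
  choose u hu using fun i => (quadRadical c).mkQ_surjective (w i)
  obtain ⟨x, hx, hx0⟩ := exists_isotropic_combination c u
  have h1 := (Submodule.Quotient.mk_eq_zero _).mpr (hc _ hx0)
  refine hx (funext fun i => Fintype.linearIndependent_iff.mp hw x ?_ i)
  rw [← Submodule.mkQ_apply, map_sum] at h1
  simpa [hu] using h1

end Radical

/-! ### Normal form of the irreducible forms of rank two -/

section NormalForm

variable {F ι : Type*} [Field F] [Fintype ι] [DecidableEq ι]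

lemma quadPolar_eq (c : Sym2 ι → F) (x y : ι → F) :
    quadPolar c x y = quadEval c (x + y) - quadEval c x - quadEval c y := by
  rw [quadEval_add_vec]
  ring

/-- A subspace of codimension `r` is cut out by `r` independent linear forms. -/
lemma exists_linear_forms {R : Submodule F (ι → F)} {r : ℕ}
    (hR : Module.finrank F ((ι → F) ⧸ R) = r) :
    ∃ l : Fin r → ι → F, (∀ x : ι → F, x ∈ R ↔ ∀ i, linEval (l i) x = 0) ∧
      ∀ y : Fin r → F, ∃ x : ι → F, ∀ i, linEval (l i) x = y i := by
  let b := Module.finBasisOfFinrankEq F ((ι → F) ⧸ R) hR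
  have key : ∀ i (x : ι → F),
      linEval (fun j => b.repr (R.mkQ (Pi.single j 1)) i) x = b.repr (R.mkQ x) i := by
    intro i x
    conv_rhs => rw [pi_eq_sum_univ' x]
    simp only [map_sum, map_smul, linEval, Finsupp.coe_finsetSum, Finset.sum_apply,
      Finsupp.coe_smul, Pi.smul_apply, smul_eq_mul]
    exact sum_congr rfl fun j _ => mul_comm _ _
  refine ⟨fun i j => b.repr (R.mkQ (Pi.single j 1)) i, fun x => ?_, fun y => ?_⟩
  · simp only [key]
    rw [← Submodule.Quotient.mk_eq_zero, ← Submodule.mkQ_apply,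
      ← b.repr.map_eq_zero_iff, Finsupp.ext_iff]
    rfl
  · obtain ⟨x, hx⟩ := R.mkQ_surjective (b.equivFun.symm y)
    refine ⟨x, fun i => ?_⟩
    rw [key, hx, ← b.equivFun_apply, LinearEquiv.apply_symm_apply]

lemma quadEval_eq_of_sub_mem {c : Sym2 ι → F} {x y : ι → F} (h : x - y ∈ quadRadical c) :
    quadEval c x = quadEval c y := by
  rw [← quadEval_add_of_mem h y, add_sub_cancel]

/-- A quadratic form which is anisotropic modulo its radical, and is not a product of linear
forms, has rank two. -/
lemma finrank_quotient_quadRadical_eq_two [Finite F] {c : Sym2 ι → F}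
    (hc : IsAnisotropicModRadical c) (hc' : ¬ IsLinearProduct c) :
    Module.finrank F ((ι → F) ⧸ quadRadical c) = 2 := by
  have h2 := finrank_quotient_quadRadical_le_two hc
  have h0 : Module.finrank F ((ι → F) ⧸ quadRadical c) ≠ 0 := by
    intro h
    obtain ⟨l, hl, -⟩ := exists_linear_forms h
    have : c = 0 := eq_zero_of_quadEval_eq_zero fun x => ((hl x).mpr fun i => i.elim0).1
    exact hc' ⟨0, 0, by simp [this, prodForm]⟩
  have h1 : Module.finrank F ((ι → F) ⧸ quadRadical c) ≠ 1 := by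
    intro h
    obtain ⟨l, hl, hs⟩ := exists_linear_forms h
    obtain ⟨u, hu⟩ := hs 1
    refine hc' ⟨quadEval c u • l 0, l 0, quad_ext fun x => ?_⟩
    rw [quadEval_eq_of_sub_mem (y := linEval (l 0) x • u), quadEval_smul_vec, quadEval_prodForm,
      linEval_smul_left, smul_eq_mul]
    · ring
    · rw [hl]
      intro i
      rw [Fin.fin_one_eq_zero i, linEval_sub, linEval_smul, hu]
      simp
  omega

/-- The quadratic form `p (X² + β X Y + γ Y²)` in the two linear forms `X`, `Y` with
coefficients `l 0`, `l 1`, where `m = (β, γ)`. -/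
def binaryForm (l : Fin 2 → ι → F) (p : F) (m : F × F) : Sym2 ι → F :=
  p • (prodForm (l 0) (l 0) + m.1 • prodForm (l 0) (l 1) + m.2 • prodForm (l 1) (l 1))

lemma quadEval_binaryForm (l : Fin 2 → ι → F) (p : F) (m : F × F) (x : ι → F) :
    quadEval (binaryForm l p m) x = p * (linEval (l 0) x ^ 2 +
      m.1 * (linEval (l 0) x * linEval (l 1) x) + m.2 * linEval (l 1) x ^ 2) := by
  simp only [binaryForm, quadEval_smul, quadEval_add, quadEval_prodForm, smul_eq_mul]
  ring

/-- An anisotropic form of rank two is a nonzero multiple of `X² + β X Y + γ Y²`, where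
`T² + β T + γ` has no root. -/
lemma exists_eq_binaryForm [Fintype F] {c : Sym2 ι → F} (hc : IsAnisotropicModRadical c)
    {l : Fin 2 → ι → F} (hl : ∀ x : ι → F, x ∈ quadRadical c ↔ ∀ i, linEval (l i) x = 0)
    (hs : ∀ y : Fin 2 → F, ∃ x : ι → F, ∀ i, linEval (l i) x = y i) :
    ∃ p m, p ≠ 0 ∧ m ∈ rootlessQuadratics F ∧ c = binaryForm l p m := by
  obtain ⟨u, hu⟩ := hs ![1, 0]
  obtain ⟨w, hw⟩ := hs ![0, 1]
  have hu0 : linEval (l 0) u = 1 := hu 0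
  have hu1 : linEval (l 1) u = 0 := hu 1
  have hw0 : linEval (l 0) w = 0 := hw 0
  have hw1 : linEval (l 1) w = 1 := hw 1
  have hp : quadEval c u ≠ 0 := fun h => by
    have := (hl u).mp (hc u h) 0
    exact one_ne_zero (hu0.symm.trans this)
  have hform : c = binaryForm l (quadEval c u)
      (quadPolar c u w / quadEval c u, quadEval c w / quadEval c u) := by
    refine quad_ext fun x => ?_
    rw [quadEval_eq_of_sub_mem (y := linEval (l 0) x • u + linEval (l 1) x • w),
      quadEval_binaryForm, quadEval_add_vec, quadEval_smul_vec, quadEval_smul_vec,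
      quadPolar_smul_left, quadPolar_smul_right]
    · field_simp
      ring
    · rw [hl, Fin.forall_fin_two]
      simp only [linEval_sub, linEval_add, linEval_smul, hu0, hu1, hw0, hw1]
      constructor <;> ring
  refine ⟨_, _, hp, ?_, hform⟩
  simp only [rootlessQuadratics, mem_filter, mem_univ, true_and]
  intro t ht
  obtain ⟨x, hx⟩ := hs ![t, 1]
  have hx0 : linEval (l 0) x = t := hx 0
  have hx1 : linEval (l 1) x = 1 := hx 1
  have : quadEval c x = 0 := by
    rw [hform, quadEval_binaryForm, hx0, hx1]
    linear_combination quadEval c u * ht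
  have := (hl x).mp (hc x this) 1
  exact one_ne_zero (hx1.symm.trans this)

lemma binaryForm_injective {l : Fin 2 → ι → F}
    (hs : ∀ y : Fin 2 → F, ∃ x : ι → F, ∀ i, linEval (l i) x = y i)
    {p p' : F} {m m' : F × F} (hp : p ≠ 0) (h : binaryForm l p m = binaryForm l p' m') :
    p = p' ∧ m = m' := by
  have key : ∀ s t : F, p * (s ^ 2 + m.1 * (s * t) + m.2 * t ^ 2) =
      p' * (s ^ 2 + m'.1 * (s * t) + m'.2 * t ^ 2) := by
    intro s t
    obtain ⟨x, hx⟩ := hs ![s, t]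
    have hx0 : linEval (l 0) x = s := hx 0
    have hx1 : linEval (l 1) x = t := hx 1
    have := congrArg (fun c => quadEval c x) h
    simpa only [quadEval_binaryForm, hx0, hx1] using this
  have h1 : p = p' := by linear_combination key 1 0
  subst h1
  have h2 : m.2 = m'.2 := mul_left_cancel₀ hp (by linear_combination key 0 1)
  have h3 : m.1 = m'.1 := mul_left_cancel₀ hp (by linear_combination key 1 1 - p * h2)
  exact ⟨rfl, Prod.ext h3 h2⟩

section Split

variable [Fintype F] {l : Fin 2 → ι → F} {p : F} {m : F × F}

lemma isLinearProduct_binaryForm (hm : m ∈ splitQuadratics F) :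
    IsLinearProduct (binaryForm l p m) := by
  simp only [splitQuadratics, mem_filter, mem_univ, true_and] at hm
  obtain ⟨s, t, -, h1, h2⟩ := hm
  refine ⟨p • (l 0 + (-s) • l 1), l 0 + (-t) • l 1, quad_ext fun x => ?_⟩
  simp only [quadEval_binaryForm, quadEval_prodForm, linEval_smul_left, linEval_add_left,
    smul_eq_mul, h1, h2]
  ring

lemma not_isAnisotropicModRadical_binaryForm (hp : p ≠ 0) (hm : m ∈ splitQuadratics F)
    (hs : ∀ y : Fin 2 → F, ∃ x : ι → F, ∀ i, linEval (l i) x = y i) :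
    ¬ IsAnisotropicModRadical (binaryForm l p m) := by
  simp only [splitQuadratics, mem_filter, mem_univ, true_and] at hm
  obtain ⟨s, t, hst, h1, h2⟩ := hm
  obtain ⟨x, hx⟩ := hs ![s, 1]
  have hx0 : linEval (l 0) x = s := hx 0
  have hx1 : linEval (l 1) x = 1 := hx 1
  obtain ⟨u, hu⟩ := hs ![1, 0]
  have hu0 : linEval (l 0) u = 1 := hu 0
  have hu1 : linEval (l 1) u = 0 := hu 1
  intro h
  have hx := (h x (by rw [quadEval_binaryForm, hx0, hx1, h1, h2]; ring)).2 u
  rw [quadPolar_eq] at hx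
  simp only [quadEval_binaryForm, linEval_add, hx0, hx1, hu0, hu1, h1, h2] at hx
  exact mul_ne_zero hp (sub_ne_zero.mpr hst) (by linear_combination hx)

lemma mem_quadRadical_binaryForm (hp : p ≠ 0) (hm : m ∈ splitQuadratics F)
    (hs : ∀ y : Fin 2 → F, ∃ x : ι → F, ∀ i, linEval (l i) x = y i) (x : ι → F) :
    x ∈ quadRadical (binaryForm l p m) ↔ ∀ i, linEval (l i) x = 0 := by
  simp only [splitQuadratics, mem_filter, mem_univ, true_and] at hm
  obtain ⟨s, t, hst, h1, h2⟩ := hm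
  rw [mem_quadRadical, Fin.forall_fin_two]
  constructor
  · rintro ⟨-, hx⟩
    have key : ∀ v w : F, 2 * v * linEval (l 0) x +
        m.1 * (v * linEval (l 1) x + w * linEval (l 0) x) + 2 * m.2 * w * linEval (l 1) x = 0 := by
      intro v w
      obtain ⟨u, hu⟩ := hs ![v, w]
      have hu0 : linEval (l 0) u = v := hu 0
      have hu1 : linEval (l 1) u = w := hu 1
      have h := hx u
      rw [quadPolar_eq] at h
      simp only [quadEval_binaryForm, linEval_add, hu0, hu1] at h
      exact mul_left_cancel₀ hp (by linear_combination h)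
    -- Evaluating the polar form at the zeros `(s, 1)` and `(t, 1)` of the form gives
    -- `(s - t) (X - s Y)` and `(t - s) (X - t Y)`.
    have e1 := key s 1
    have e2 := key t 1
    rw [h1, h2] at e1 e2
    have hst' := sub_ne_zero.mpr hst
    have f1 : linEval (l 0) x = s * linEval (l 1) x :=
      mul_left_cancel₀ hst' (by linear_combination e1)
    have f2 : linEval (l 0) x = t * linEval (l 1) x :=
      mul_left_cancel₀ hst' (by linear_combination -e2)
    have f3 : linEval (l 1) x = 0 := mul_left_cancel₀ hst' (by linear_combination f2 - f1)
    exact ⟨by rw [f1, f3, mul_zero], f3⟩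
  · rintro ⟨hx0, hx1⟩
    refine ⟨by simp [quadEval_binaryForm, hx0, hx1], fun y => ?_⟩
    rw [quadPolar_eq]
    simp [quadEval_binaryForm, linEval_add, hx0, hx1]

end Split

/-- Irreducible forms of rank two are at most as many as the products of two non-proportional
linear forms: the radical is kept, and in fixed coordinates modulo the radical a rootless
dehomogenized polynomial is replaced by a split one. -/
lemma exists_injOn_anisotropic [Fintype F] : ∃ Φ : (Sym2 ι → F) → (Sym2 ι → F),
    (∀ c, IsAnisotropicModRadical c ∧ ¬ IsLinearProduct c →
      ¬ IsAnisotropicModRadical (Φ c) ∧ IsLinearProduct (Φ c)) ∧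
    Set.InjOn Φ {c | IsAnisotropicModRadical c ∧ ¬ IsLinearProduct c} := by
  obtain ⟨φ, hφ, hφi⟩ := exists_rootless_to_split F
  choose! l hl hs using fun (R : Submodule F (ι → F))
    (hR : Module.finrank F ((ι → F) ⧸ R) = 2) => exists_linear_forms hR
  have hex : ∀ c : Sym2 ι → F, IsAnisotropicModRadical c ∧ ¬ IsLinearProduct c →
      ∃ p m, p ≠ 0 ∧ m ∈ rootlessQuadratics F ∧ c = binaryForm (l (quadRadical c)) p m :=
    fun c hc => by
      have h2 := finrank_quotient_quadRadical_eq_two hc.1 hc.2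
      exact exists_eq_binaryForm hc.1 (hl _ h2) (hs _ h2)
  choose! p m hp hm hform using hex
  have hs' : ∀ c, IsAnisotropicModRadical c ∧ ¬ IsLinearProduct c →
      ∀ y : Fin 2 → F, ∃ x : ι → F, ∀ i, linEval (l (quadRadical c) i) x = y i := fun c hc =>
    hs _ (finrank_quotient_quadRadical_eq_two hc.1 hc.2)
  refine ⟨fun c => binaryForm (l (quadRadical c)) (p c) (φ (m c)), fun c hc => ⟨?_, ?_⟩, ?_⟩
  · exact not_isAnisotropicModRadical_binaryForm (hp c hc) (hφ _ (hm c hc)) (hs' c hc)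
  · exact isLinearProduct_binaryForm (hφ _ (hm c hc))
  · intro c hc d hd hcd
    have hrad : ∀ c, IsAnisotropicModRadical c ∧ ¬ IsLinearProduct c →
        quadRadical (binaryForm (l (quadRadical c)) (p c) (φ (m c))) = quadRadical c := by
      intro c hc
      ext x
      rw [mem_quadRadical_binaryForm (hp c hc) (hφ _ (hm c hc)) (hs' c hc),
        hl _ (finrank_quotient_quadRadical_eq_two hc.1 hc.2)]
    have hR : quadRadical c = quadRadical d := by
      rw [← hrad c hc, ← hrad d hd]
      exact congrArg quadRadical hcd
    simp only [← hR] at hcd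
    obtain ⟨h1, h2⟩ := binaryForm_injective (hs' c hc) (hp c hc) hcd
    rw [hform c hc, hform d hd, ← hR, h1, hφi (hm c hc) (hm d hd) h2]

end NormalForm

/-! ### Summation over all quadratic forms -/

section TotalCount

variable {F L ι : Type*} [Field F] [Fintype ι] [DecidableEq ι]

lemma isAnisotropicModRadical_sq (a : ι → F) : IsAnisotropicModRadical (prodForm a a) := by
  intro e he
  refine ⟨he, fun x => ?_⟩
  rw [quadEval_prodForm, mul_self_eq_zero] at he
  rw [quadPolar_eq]
  simp [quadEval_prodForm, linEval_add, he]

variable [Fintype F]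

open Classical in
/-- Besides zero, the squares of the linear forms whose coefficient at one chosen variable is `1`
are anisotropic modulo the radical. -/
lemma le_card_anisotropic_products [Nonempty ι] :
    Fintype.card F ^ (Fintype.card ι - 1) + 1 ≤
      #{c : Sym2 ι → F | IsAnisotropicModRadical c ∧ IsLinearProduct c} := by
  obtain ⟨i⟩ := ‹Nonempty ι›
  let a : ({j : ι // j ≠ i} → F) → ι → F := fun g j => if h : j = i then 1 else g ⟨j, h⟩
  have hai : ∀ g, a g i = 1 := fun g => by simp [a]
  have haj : ∀ g (j : {j : ι // j ≠ i}), a g j = g j := fun g j => by simp [a, j.2]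
  let f : Option ({j : ι // j ≠ i} → F) → Sym2 ι → F
    | none => 0
    | some g => prodForm (a g) (a g)
  have hne : ∀ g, prodForm (a g) (a g) ≠ 0 := by
    intro g h
    have := congrArg (fun c => quadEval c (Pi.single i (1 : F))) h
    simp [quadEval_prodForm, quadEval_zero, linEval_single, hai] at this
  have hcard : Fintype.card (Option ({j : ι // j ≠ i} → F)) =
      Fintype.card F ^ (Fintype.card ι - 1) + 1 := by
    simp
  rw [← hcard, ← Finset.card_univ]
  refine card_le_card_of_injOn f ?_ ?_
  · rintro (_ | g) -
    · have : f none = prodForm 0 0 := by simp [f, prodForm]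
      simpa [this] using ⟨isAnisotropicModRadical_sq (0 : ι → F), 0, 0, rfl⟩
    · simpa using ⟨isAnisotropicModRadical_sq (a g), a g, a g, rfl⟩
  · rintro (_ | g) - (_ | g') - h
    · rfl
    · exact absurd h.symm (hne g')
    · exact absurd h (hne g)
    · refine congrArg some (funext fun j => ?_)
      have h1 := congrArg (fun c => quadEval c
        ((Pi.single (j : ι) 1 : ι → F) + (-g j) • (Pi.single i 1 : ι → F))) h
      simp only [f, quadEval_prodForm, linEval_add, linEval_smul, linEval_single, hai, haj,
        Algebra.algebraMap_self, RingHom.id_apply] at h1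
      have h2 : (g' j - g j) * (g' j - g j) = 0 := by linear_combination -h1
      exact (sub_eq_zero.mp (mul_self_eq_zero.mp h2)).symm

variable [Field L] [Algebra F L] [Fintype L]

open Classical in
/-- The total number of independent zeros of all nonzero quadratic forms. Forms with a zero outside
the radical have weight one, irreducible forms of rank two have weight two and products of linear
forms have weight zero; the excess of the second kind is absorbed by the last. -/
lemma sum_card_indepZeros_mul_le [Nonempty ι] :
    (∑ c : Sym2 ι → F with c ≠ 0, #(indepZeros L c)) *
      (Fintype.card L - Fintype.card F ^ (Fintype.card ι - 1)) +
        (Fintype.card F ^ (Fintype.card ι - 1) + 1) * #(indepTuples F L ι) ≤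
      Fintype.card F ^ (Fintype.card ι + 1).choose 2 * #(indepTuples F L ι) := by
  set T := #(indepTuples F L ι)
  set D := Fintype.card L - Fintype.card F ^ (Fintype.card ι - 1)
  let P : (Sym2 ι → F) → Prop := IsAnisotropicModRadical
  let R : (Sym2 ι → F) → Prop := IsLinearProduct
  let w : (Sym2 ι → F) → ℕ := fun c =>
    (if ¬ P c ∧ ¬ R c then 1 else 0) + 2 * (if P c ∧ ¬ R c then 1 else 0)
  have hw : ∀ c : Sym2 ι → F, c ≠ 0 → #(indepZeros L c) * D ≤ w c * T := by
    intro c hc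
    by_cases hR : R c
    · have : indepZeros L c = ∅ := by
        obtain ⟨a, b, rfl⟩ := hR
        exact indepZeros_prodForm hc
      simp [this]
    · by_cases hP : P c
      · simpa [w, hP, hR] using card_indepZeros_mul_le_two (L := L) hc
      · have hP' := hP
        simp only [P, IsAnisotropicModRadical, mem_quadRadical] at hP'
        push Not at hP'
        obtain ⟨e, he, he'⟩ := hP'
        obtain ⟨x, hx⟩ := he' he
        simpa [w, hP, hR] using card_indepZeros_mul_le_one (L := L) he hx
  have h1 : (∑ c : Sym2 ι → F with c ≠ 0, #(indepZeros L c)) * D ≤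
      (#{c | ¬ P c ∧ ¬ R c} + 2 * #{c | P c ∧ ¬ R c}) * T := by
    calc (∑ c : Sym2 ι → F with c ≠ 0, #(indepZeros L c)) * D
        ≤ ∑ c : Sym2 ι → F with c ≠ 0, w c * T := by
          rw [sum_mul]
          exact sum_le_sum fun c hc => hw c (mem_filter.mp hc).2
      _ ≤ ∑ c : Sym2 ι → F, w c * T :=
          sum_le_sum_of_subset (filter_subset _ _)
      _ = _ := by
          rw [← sum_mul, sum_add_distrib, ← mul_sum]
          simp
  have h2 : #{c | P c ∧ ¬ R c} ≤ #{c | ¬ P c ∧ R c} := by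
    obtain ⟨Φ, hΦ, hΦi⟩ := exists_injOn_anisotropic (F := F) (ι := ι)
    refine card_le_card_of_injOn Φ (fun c hc => ?_) ?_
    · simpa using hΦ c (by simpa using hc)
    · simpa using hΦi
  have h3 : Fintype.card F ^ (Fintype.card ι - 1) + 1 ≤ #{c | P c ∧ R c} :=
    le_card_anisotropic_products
  have h4 : #{c | P c ∧ R c} + #{c | P c ∧ ¬ R c} + (#{c | ¬ P c ∧ R c} + #{c | ¬ P c ∧ ¬ R c}) =
      Fintype.card F ^ (Fintype.card ι + 1).choose 2 := by
    have hK : Fintype.card (Sym2 ι → F) = Fintype.card F ^ (Fintype.card ι + 1).choose 2 := by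
      rw [Fintype.card_fun, Sym2.card]
    rw [← hK, ← Finset.card_univ, ← card_filter_add_card_filter_not (s := univ) P,
      ← card_filter_add_card_filter_not (s := univ.filter P) R,
      ← card_filter_add_card_filter_not (s := univ.filter fun c => ¬ P c) R]
    simp only [filter_filter]
  calc _ ≤ (#{c | ¬ P c ∧ ¬ R c} + 2 * #{c | P c ∧ ¬ R c}) * T + #{c | P c ∧ R c} * T :=
        add_le_add h1 (Nat.mul_le_mul_right _ h3)
    _ = (#{c | ¬ P c ∧ ¬ R c} + 2 * #{c | P c ∧ ¬ R c} + #{c | P c ∧ R c}) * T := by ring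
    _ ≤ _ := Nat.mul_le_mul_right _ (by omega)

open Classical in
/-- Every independent tuple annihilated by some nonzero quadratic form is annihilated by all its
nonzero multiples. -/
lemma card_degenerate_mul_le :
    (Fintype.card F - 1) * #{v : ι → L | LinearIndependent F v ∧
      ∃ c : Sym2 ι → F, c ≠ 0 ∧ quadEval c v = 0} ≤
      ∑ c : Sym2 ι → F with c ≠ 0, #(indepZeros L c) := by
  have : ∑ c : Sym2 ι → F with c ≠ 0, #(indepZeros L c) =
      ∑ v : ι → L, #{c : Sym2 ι → F | c ≠ 0 ∧ LinearIndependent F v ∧ quadEval c v = 0} := by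
    simp only [indepZeros, card_filter, sum_filter]
    rw [sum_comm]
    refine sum_congr rfl fun c _ => ?_
    by_cases h : c = 0 <;> simp [h]
  rw [this, mul_comm, ← smul_eq_mul]
  refine le_trans (card_nsmul_le_sum _ _ _ ?_) (sum_le_sum_of_subset (filter_subset _ _))
  intro v hv
  simp only [mem_filter, mem_univ, true_and] at hv
  obtain ⟨hv, c, hc, hcv⟩ := hv
  rw [← Fintype.card_units, ← Finset.card_univ]
  refine card_le_card_of_injOn (fun r : Fˣ => (r : F) • c) (fun r _ => ?_) fun r _ r' _ h => ?_
  · simp [hc, hv, quadEval_smul, hcv]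
  · exact Units.ext (smul_left_injective F hc h)

end TotalCount

/-! ### Max-span Sidon spaces -/

section MaxSpan

variable {F L ι : Type*} [Field F] [Field L] [Algebra F L] [Fintype ι]

lemma mem_span_range_iff_linEval {v : ι → L} {x : L} :
    x ∈ Submodule.span F (Set.range v) ↔ ∃ a : ι → F, linEval a v = x :=
  Submodule.mem_span_range_iff_exists_fun F

variable [DecidableEq ι]

/-- Unique factorization for products of two linear forms. The kernel of `a` lies in the union of
the kernels of `c` and `d`, hence in one of them, as a vector space is not the union of two
proper subspaces. -/
lemma proportional_of_prodForm_eq {a b c d : ι → F} (ha : a ≠ 0)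
    (h : prodForm a b = prodForm c d) : (∃ r : F, c = r • a) ∨ ∃ r : F, d = r • a := by
  have h' : ∀ x : ι → F, linEval a x * linEval b x = linEval c x * linEval d x := fun x => by
    rw [← quadEval_prodForm, ← quadEval_prodForm, h]
  have key : ∀ e : ι → F, (∀ x : ι → F, linEval a x = 0 → linEval e x = 0) →
      ∃ r : F, e = r • a := by
    intro e he
    obtain ⟨i, hi⟩ := Function.ne_iff.mp ha
    have hi' : a i ≠ 0 := hi
    refine ⟨e i / a i, funext fun j => ?_⟩
    have := he (Pi.single j 1 - (a j / a i) • Pi.single i 1) (by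
      simp only [linEval_sub, linEval_smul, linEval_single, Algebra.algebraMap_self,
        RingHom.id_apply]
      field_simp
      ring)
    simp only [linEval_sub, linEval_smul, linEval_single, Algebra.algebraMap_self,
      RingHom.id_apply] at this
    rw [sub_eq_zero.mp this, Pi.smul_apply, smul_eq_mul]
    ring
  by_cases hc : ∀ x : ι → F, linEval a x = 0 → linEval c x = 0
  · exact .inl (key c hc)
  by_cases hd : ∀ x : ι → F, linEval a x = 0 → linEval d x = 0
  · exact .inr (key d hd)
  push Not at hc hd
  obtain ⟨x, hx, hcx⟩ := hc
  obtain ⟨y, hy, hdy⟩ := hd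
  have h1 := h' x
  have h2 := h' y
  have h3 := h' (x + y)
  simp only [linEval_add, hx, hy, zero_mul, zero_add] at h1 h2 h3
  have hdx : linEval d x = 0 := by simpa [hcx] using h1.symm
  have hcy : linEval c y = 0 := by simpa [hdy] using h2.symm
  rw [hdx, hcy, add_zero, zero_add] at h3
  exact absurd h3.symm (mul_ne_zero hcx hdy)

lemma squareSpan_span_range (v : ι → L) :
    squareSpan (Submodule.span F (Set.range v)) =
      Submodule.span F (Set.range fun z : Sym2 ι => (z.map v).mul) := by
  refine le_antisymm (Submodule.span_le.mpr ?_) (Submodule.span_le.mpr ?_)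
  · rintro _ ⟨u, hu, w, hw, rfl⟩
    obtain ⟨a, rfl⟩ := mem_span_range_iff_linEval.mp hu
    obtain ⟨b, rfl⟩ := mem_span_range_iff_linEval.mp hw
    exact (Submodule.mem_span_range_iff_exists_fun F).mpr
      ⟨prodForm a b, quadEval_prodForm a b v⟩
  · rintro _ ⟨z, rfl⟩
    induction z with | _ i j => ?_
    exact Submodule.subset_span ⟨v i, Submodule.subset_span ⟨i, rfl⟩, v j,
      Submodule.subset_span ⟨j, rfl⟩, by simp⟩

lemma span_pair_eq_of_smul {r : F} {a b c d : L} (ha : a ≠ 0) (hc : c ≠ 0) (hr : c = r • a)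
    (h : a * b = c * d) :
    Submodule.span F {a} = Submodule.span F {c} ∧ Submodule.span F {b} = Submodule.span F {d} := by
  have hr0 : IsUnit r := by
    rw [isUnit_iff_ne_zero]
    rintro rfl
    exact hc (by rw [hr, zero_smul])
  have hb : b = r • d := mul_left_cancel₀ ha (by
    rw [h, hr, smul_mul_assoc, mul_smul_comm])
  rw [hr, hb, Submodule.span_singleton_smul_eq hr0, Submodule.span_singleton_smul_eq hr0]
  exact ⟨rfl, rfl⟩

/-- A basis annihilated by no nonzero quadratic form spans a max-span Sidon space: its products
are then linearly independent, and equal products of elements come from equal products of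
linear forms. -/
lemma isMaxSpanSidonSpace_span {v : ι → L} (hv : LinearIndependent F v)
    (h : ∀ c : Sym2 ι → F, quadEval c v = 0 → c = 0) :
    IsMaxSpanSidonSpace (Submodule.span F (Set.range v)) := by
  constructor
  · intro a ha b hb c hc d hd ha0 hb0 hc0 hd0 habcd
    obtain ⟨α, rfl⟩ := mem_span_range_iff_linEval.mp ha
    obtain ⟨β, rfl⟩ := mem_span_range_iff_linEval.mp hb
    obtain ⟨γ, rfl⟩ := mem_span_range_iff_linEval.mp hc
    obtain ⟨δ, rfl⟩ := mem_span_range_iff_linEval.mp hd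
    have hforms : prodForm α β = prodForm γ δ := by
      have : prodForm α β + (-1 : F) • prodForm γ δ = 0 := h _ (by
        rw [quadEval_add, quadEval_smul, quadEval_prodForm, quadEval_prodForm, habcd]
        simp)
      simpa [← sub_eq_add_neg, sub_eq_zero] using this
    have hα : α ≠ 0 := by
      rintro rfl
      exact ha0 (by simp [linEval])
    rcases proportional_of_prodForm_eq hα hforms with ⟨r, hr⟩ | ⟨r, hr⟩
    · obtain ⟨h1, h2⟩ := span_pair_eq_of_smul (F := F) ha0 hc0
        (by rw [hr, linEval_smul_left]) habcd
      rw [h1, h2]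
    · obtain ⟨h1, h2⟩ := span_pair_eq_of_smul (F := F) ha0 hd0
        (by rw [hr, linEval_smul_left]) (habcd.trans (mul_comm _ _))
      rw [h1, h2, Set.pair_comm]
  · have hprod : LinearIndependent F fun z : Sym2 ι => (z.map v).mul :=
      Fintype.linearIndependent_iff.mpr fun c hc z => congrFun (h c hc) z
    rw [squareSpan_span_range, finrank_span_eq_card hprod, finrank_span_eq_card hv, Sym2.card]

end MaxSpan

/-! ### From tuples to subspaces -/

section Subspaces

variable {F L : Type*} [Field F] [Field L] [Algebra F L] [Fintype F] [Fintype L]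

open Classical in
lemma card_bases_of_subspace {k : ℕ} {V : Submodule F L} (hV : Module.finrank F V = k) :
    #{v : Fin k → L | LinearIndependent F v ∧ Submodule.span F (Set.range v) = V} =
      ∏ i : Fin k, (Fintype.card F ^ k - Fintype.card F ^ (i : ℕ)) := by
  have h := card_linearIndependent (K := F) (V := V) (k := k) hV.ge
  rw [hV] at h
  rw [← h, Nat.card_eq_fintype_card, ← Finset.card_univ]
  symm
  refine card_bij (fun s _ i => (s.1 i : L)) (fun s _ => ?_) (fun s _ t _ hst => ?_) fun v hv => ?_
  · have hs : LinearIndependent F (fun i => (s.1 i : L)) := s.2.map' V.subtype V.ker_subtype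
    simp only [mem_filter, mem_univ, true_and]
    refine ⟨hs, Submodule.eq_of_le_of_finrank_eq (Submodule.span_le.mpr ?_) ?_⟩
    · rintro _ ⟨i, rfl⟩
      exact (s.1 i).2
    · rw [finrank_span_eq_card hs, hV, Fintype.card_fin]
  · exact Subtype.ext (funext fun i => Subtype.ext (congrFun hst i))
  · simp only [mem_filter, mem_univ, true_and] at hv
    obtain ⟨hv, rfl⟩ := hv
    exact ⟨⟨fun i => ⟨v i, Submodule.subset_span ⟨i, rfl⟩⟩, linearIndependent_span hv⟩,
      mem_univ _, rfl⟩

open Classical in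
/-- Every set of `k`-dimensional subspaces has the same number of bases per member. -/
lemma card_bases_of_subspaces {k : ℕ} (S : Finset (Submodule F L))
    (hS : ∀ V ∈ S, Module.finrank F V = k) :
    #{v : Fin k → L | LinearIndependent F v ∧ Submodule.span F (Set.range v) ∈ S} =
      #S * ∏ i : Fin k, (Fintype.card F ^ k - Fintype.card F ^ (i : ℕ)) := by
  rw [card_eq_sum_card_fiberwise (f := fun v => Submodule.span F (Set.range v)) (t := S)
    (fun v hv => by simpa using (mem_filter.mp hv).2.2), ← smul_eq_mul]
  refine sum_eq_card_nsmul fun V hV => ?_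
  rw [← card_bases_of_subspace (hS V hV), filter_filter]
  congr 1
  refine filter_congr fun v _ => ?_
  constructor
  · rintro ⟨⟨h1, -⟩, h2⟩
    exact ⟨h1, h2⟩
  · rintro ⟨h1, h2⟩
    exact ⟨⟨h1, h2 ▸ hV⟩, h2⟩

open Classical in
/-- The count of independent tuples, divided by the number of bases of a `k`-dimensional space. -/
lemma card_not_isMaxSpanSidonSpace_mul_le {k : ℕ} (hk : 0 < k) :
    (Fintype.card F - 1) * #{V : Submodule F L | Module.finrank F V = k ∧
        ¬ IsMaxSpanSidonSpace V} * (Fintype.card L - Fintype.card F ^ (k - 1)) +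
      (Fintype.card F ^ (k - 1) + 1) * #{V : Submodule F L | Module.finrank F V = k} ≤
      Fintype.card F ^ (k + 1).choose 2 * #{V : Submodule F L | Module.finrank F V = k} := by
  have : Nonempty (Fin k) := ⟨⟨0, hk⟩⟩
  set g := ∏ i : Fin k, (Fintype.card F ^ k - Fintype.card F ^ (i : ℕ)) with hg
  set D := Fintype.card L - Fintype.card F ^ (k - 1)
  set S : Finset (Submodule F L) := {V | Module.finrank F V = k ∧ ¬ IsMaxSpanSidonSpace V} with hS
  set G : Finset (Submodule F L) := {V | Module.finrank F V = k} with hG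
  have hg0 : 0 < g := Finset.prod_pos fun i _ => Nat.sub_pos_of_lt
    (Nat.pow_lt_pow_right Fintype.one_lt_card i.2)
  have h1 := sum_card_indepZeros_mul_le (F := F) (L := L) (ι := Fin k)
  have h2 := card_degenerate_mul_le (F := F) (L := L) (ι := Fin k)
  rw [Fintype.card_fin] at h1
  have hT : #(indepTuples F L (Fin k)) = #G * g := by
    rw [hg, ← card_bases_of_subspaces G (by simp [hG]), indepTuples]
    congr 1
    ext v
    simp only [hG, mem_filter, mem_univ, true_and, iff_self_and]
    intro hv
    rw [finrank_span_eq_card hv, Fintype.card_fin]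
  have hB : #S * g ≤ #{v : Fin k → L | LinearIndependent F v ∧
      ∃ c : Sym2 (Fin k) → F, c ≠ 0 ∧ quadEval c v = 0} := by
    rw [hg, ← card_bases_of_subspaces S (fun V hV => by
      simp only [hS, mem_filter, mem_univ, true_and] at hV; exact hV.1)]
    refine card_le_card fun v hv => ?_
    simp only [hS, mem_filter, mem_univ, true_and] at hv ⊢
    refine ⟨hv.1, ?_⟩
    by_contra! h
    exact hv.2.2 (isMaxSpanSidonSpace_span hv.1 fun c hc => by_contra fun h0 => h c h0 hc)
  rw [hT] at h1
  refine Nat.le_of_mul_le_mul_right ?_ hg0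
  calc _ = (Fintype.card F - 1) * (#S * g) * D +
        (Fintype.card F ^ (k - 1) + 1) * (#G * g) := by ring
    _ ≤ _ := (Nat.add_le_add_right (Nat.mul_le_mul_right _
        ((Nat.mul_le_mul_left _ hB).trans h2)) _).trans h1
    _ = _ := by ring

end Subspaces

theorem mainTheorem7 (F L : Type*) [Field F] [Finite F] [Field L] [Algebra F L]
    [FiniteDimensional F L] (q n k : ℕ) (hq : Nat.card F = q) (hn : Module.finrank F L = n)
    (hk : 0 < k) (hkn : (k + 1).choose 2 ≤ n) :
    ({V ∈ grassmannian F L k | ¬ IsMaxSpanSidonSpace V}.ncard : ℝ) /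
        ((grassmannian F L k).ncard : ℝ) <
      1 / ((q : ℝ) - 1) * (q : ℝ) ^ (((k * (k + 1) / 2 : ℕ) : ℤ) - (n : ℤ)) := by
  classical
  have := Fintype.ofFinite F
  have : Finite L := Module.finite_of_finite F
  have := Fintype.ofFinite L
  have main := card_not_isMaxSpanSidonSpace_mul_le (F := F) (L := L) hk
  have hcF : Fintype.card F = q := by rw [← hq, Nat.card_eq_fintype_card]
  have hcL : Fintype.card L = q ^ n := by rw [Module.card_eq_pow_finrank (K := F), hcF, hn]
  have hq1 : 1 < q := hcF ▸ Fintype.one_lt_card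
  have hK : k * (k + 1) / 2 = (k + 1).choose 2 := by
    rw [Nat.choose_two_right, Nat.add_sub_cancel, mul_comm]
  have hkK : k ≤ (k + 1).choose 2 := by
    rw [Nat.choose_succ_succ', Nat.choose_one_right]
    omega
  rw [hcF, hcL] at main
  have hB : {V ∈ grassmannian F L k | ¬ IsMaxSpanSidonSpace V}.ncard =
      #{V : Submodule F L | Module.finrank F V = k ∧ ¬ IsMaxSpanSidonSpace V} := by
    rw [← Set.ncard_coe_finset]
    simp [grassmannian]
  have hG : (grassmannian F L k).ncard = #{V : Submodule F L | Module.finrank F V = k} := by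
    rw [← Set.ncard_coe_finset]
    simp [grassmannian]
  have hG0 : 0 < #{V : Submodule F L | Module.finrank F V = k} := by
    obtain ⟨v, hv⟩ := exists_linearIndependent_of_le_finrank (R := F) (M := L) (n := k)
      (by omega)
    exact card_pos.mpr ⟨Submodule.span F (Set.range v), by simp [finrank_span_eq_card hv]⟩
  rw [hB, hG, hK]
  generalize #{V : Submodule F L | Module.finrank F V = k ∧ ¬ IsMaxSpanSidonSpace V} = b at main ⊢
  generalize #{V : Submodule F L | Module.finrank F V = k} = N at main hG0 ⊢
  have hm : q ^ (k - 1) < q ^ n := Nat.pow_lt_pow_right hq1 (by omega)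
  have hs : q ^ (k + 1).choose 2 ≤ q ^ n := Nat.pow_le_pow_right hq1.le hkn
  have hs0 : (0 : ℝ) < (q : ℝ) ^ n := by positivity
  have hq1' : (0 : ℝ) < (q : ℝ) - 1 := by
    rw [sub_pos]
    exact_mod_cast hq1
  rw [zpow_sub₀ (by positivity), zpow_natCast, zpow_natCast, one_div_mul_eq_div, div_div,
    div_lt_div_iff₀ (by exact_mod_cast hG0) (by positivity)]
  have main' : ((q : ℝ) - 1) * b * ((q : ℝ) ^ n - (q : ℝ) ^ (k - 1)) +
      ((q : ℝ) ^ (k - 1) + 1) * N ≤ (q : ℝ) ^ (k + 1).choose 2 * N := by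
    have h : (((q - 1) * b * (q ^ n - q ^ (k - 1)) + (q ^ (k - 1) + 1) * N : ℕ) : ℝ) ≤
      ((q ^ (k + 1).choose 2 * N : ℕ) : ℝ) := by exact_mod_cast main
    push_cast [Nat.cast_sub hq1.le, Nat.cast_sub hm.le] at h
    exact h
  have hm' : (q : ℝ) ^ (k - 1) < (q : ℝ) ^ n := by exact_mod_cast hm
  have hs' : (q : ℝ) ^ (k + 1).choose 2 ≤ (q : ℝ) ^ n := by exact_mod_cast hs
  have hm0 : (0 : ℝ) ≤ (q : ℝ) ^ (k - 1) := by positivity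
  have hN : (0 : ℝ) < N := by exact_mod_cast hG0
  generalize (q : ℝ) ^ (k + 1).choose 2 = x at main' hs' ⊢
  generalize (q : ℝ) ^ n = s at main' hs' hm' hs0 ⊢
  generalize (q : ℝ) ^ (k - 1) = m at main' hm' hm0
  refine lt_of_mul_lt_mul_right ?_ (sub_pos.mpr hm').le
  have h1 : x * m < s * (m + 1) :=
    (mul_le_mul_of_nonneg_right hs' hm0).trans_lt (by linarith)
  calc (b : ℝ) * (s * ((q : ℝ) - 1)) * (s - m)
      = s * (((q : ℝ) - 1) * b * (s - m)) := by ring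
    _ ≤ s * (x * N - (m + 1) * N) := mul_le_mul_of_nonneg_left (by linarith) hs0.le
    _ = x * N * (s - m) + N * (x * m - s * (m + 1)) := by ring
    _ < x * N * (s - m) := by
        have := mul_neg_of_pos_of_neg hN (sub_neg.mpr h1)
        linarith
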